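/- Let $0<r<p,q<s<\infty$ be real numbers with $\frac1r+\frac1s=\frac1p+\frac1q$. There exist $\varepsilon_0>0$ and a function $c:(0,\varepsilon_0]\to[0,\infty)$ with $c(\varepsilon)\to0$ as $\varepsilon\to0^+$, both depending only on $p,q,r,s$, such that the following holds. Let $G$ be a second countable locally compact Hausdorff abelian group with a Haar measure $\mu$ (a nonzero translation-invariant Radon measure on the Borel $\sigma$-algebra), let $f\in L^p(G)$ and $g\in L^q(G)$ be complex-valued with $\|f\|_{L^p(G)}=\|g\|_{L^q(G)}=1$, and let $0<\varepsilon\le\varepsilon_0$. Write $T^hf(x):=f(x-h)$. If $$\left(\int_G\|(T^hf)\,g\|_{L^r(G)}^s\,d\mu(h)\right)^{1/s}\ge 1-\varepsilon,$$ then there exist a compact open subgroup $H$ of $G$ and points $x_0,x_0'\in G$ such that $$\left\||f|-\mu(H)^{-1/p}1_{x_0+H}\right\|_{L^p(G)}\le c(\varepsilon)\quad\text{and}\quad\left\||g|-\mu(H)^{-1/q}1_{x_0'+H}\right\|_{L^q(G)}\le c(\varepsilon).$$ Here, for an exponent $0<a<\infty$, $\|F\|_{L^a(G)}:=\left(\int_G|F|^a\,d\mu\right)^{1/a}$,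 also when $a<1$. -/

import Mathlib

open MeasureTheory Filter Topology
open scoped ENNReal Pointwise

noncomputable section

/-- The shift `T^h f (x) = f (x - h)`. -/
def shift {G : Type*} [AddCommGroup G] (h : G) (f : G → ℂ) : G → ℂ :=
  fun x => f (x - h)

/-- The left-hand side `(∫ ‖(T^h f) g‖_{L^r}^s dμ(h))^{1/s}` of Young's inequality, as an
element of `[0, ∞]`. -/
def youngLHS {G : Type*} [AddCommGroup G] [MeasurableSpace G] (μ : Measure G) (r s : ℝ)
    (f g : G → ℂ) : ℝ≥0∞ :=
  (∫⁻ h, (eLpNorm (fun x => shift h f x * g x) (ENNReal.ofReal r) μ) ^ s ∂μ) ^ (1 / s)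

/-- The function `μ(H)^{-1/p} 1_{x₀ + H}`, which has `L^p` norm one when `0 < μ(H) < ∞`. -/
def cosetProfile {G : Type*} [AddCommGroup G] [MeasurableSpace G] (μ : Measure G) (p : ℝ)
    (H : AddSubgroup G) (x₀ : G) : G → ℝ :=
  (x₀ +ᵥ (H : Set G)).indicator (fun _ => (μ.real (H : Set G)) ^ (-(1 / p)))

end

open scoped NNReal

set_option linter.unusedSectionVars false

/-! Put A = |f|^p, B = |g|^q, σ = r/s, α = r/p - r/s, β = r/q - r/s. Then A and B are probability
densities, σ + α + β = 1, and the s-th power of the Young functional is the integral over h of (∫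
A(x-h)^(σ+α) B(x)^(σ+β) dx)^(1/σ). With the correlation C(h) = ∫ A(x-h) B(x) dx, Hölder bounds this
by the integral over G × G of a weighted geometric mean of three probability densities: A(x-h)B(x),
A(x-h)C(h) and B(x)C(h).

Near equality therefore makes these densities L¹-close (`l1Dist_le_of_le_lintegral_geom_mean`,
`exists_density_of_young`): B is close to C(· - y) for A-most y, and A(x - ·) is close to C for
B-most x. Hence a translate E of A is almost invariant under E-most translations.

Such an E is nearly uniform on a compact open subgroup (`exists_addSubgroup_l1Dist_le`): its almost
periods form a group, because the modulus of translation skips an interval of values. Finally, L¹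
closeness of the densities is carried back to L^p and L^q by uniform continuity of u ↦ u^(1/p). All
constants are fixed before G is, so they depend on the exponents only. -/

/-- The `L¹` distance of two nonnegative functions. -/
noncomputable def l1Dist {G : Type*} [MeasurableSpace G] (μ : Measure G) (u v : G → ℝ≥0) : ℝ≥0∞ :=
  ∫⁻ x, edist (u x) (v x) ∂μ

theorem NNReal.coe_le_add_edist (a b : ℝ≥0) : (a : ℝ≥0∞) ≤ b + edist a b := by
  rw [edist_nndist, NNReal.nndist_eq]
  norm_cast
  exact le_add_tsub.trans (by gcongr; exact le_max_left _ _)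

theorem NNReal.edist_le_of_le_add {a b : ℝ≥0} {c : ℝ≥0∞} (h₁ : (a : ℝ≥0∞) ≤ b + c)
    (h₂ : (b : ℝ≥0∞) ≤ a + c) : edist a b ≤ c := by
  rw [edist_nndist, NNReal.nndist_eq, ENNReal.coe_max]
  refine max_le ?_ ?_
  · rw [ENNReal.coe_sub, tsub_le_iff_left]; exact h₁
  · rw [ENNReal.coe_sub, tsub_le_iff_left]; exact h₂

theorem NNReal.edist_le_add (a b : ℝ≥0) : edist a b ≤ (a : ℝ≥0∞) + b :=
  NNReal.edist_le_of_le_add (by rw [← add_assoc, add_right_comm]; exact le_add_self)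
    (by rw [← add_assoc]; exact le_add_self)

/-! ### The L¹ distance between densities. -/

section L1Dist

variable {G : Type*} [MeasurableSpace G] {μ : Measure G}

theorem l1Dist_self (u : G → ℝ≥0) : l1Dist μ u u = 0 := by simp [l1Dist]

theorem l1Dist_comm (u v : G → ℝ≥0) : l1Dist μ u v = l1Dist μ v u := by
  simp only [l1Dist, edist_comm]

theorem l1Dist_triangle {u v : G → ℝ≥0} (w : G → ℝ≥0) (hu : Measurable u) (hv : Measurable v) :
    l1Dist μ u w ≤ l1Dist μ u v + l1Dist μ v w := by
  rw [l1Dist, l1Dist, l1Dist, ← lintegral_add_left (hu.edist hv)]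
  exact lintegral_mono fun x => edist_triangle _ _ _

theorem setLIntegral_le_add_l1Dist {u v : G → ℝ≥0} (hv : Measurable v) (S : Set G) :
    ∫⁻ x in S, (u x : ℝ≥0∞) ∂μ ≤ ∫⁻ x in S, (v x : ℝ≥0∞) ∂μ + l1Dist μ u v := by
  calc ∫⁻ x in S, (u x : ℝ≥0∞) ∂μ ≤ ∫⁻ x in S, ((v x : ℝ≥0∞) + edist (u x) (v x)) ∂μ :=
        lintegral_mono fun x => NNReal.coe_le_add_edist _ _
    _ = ∫⁻ x in S, (v x : ℝ≥0∞) ∂μ + ∫⁻ x in S, edist (u x) (v x) ∂μ :=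
        lintegral_add_left hv.coe_nnreal_ennreal _
    _ ≤ _ := by gcongr; exact setLIntegral_le_lintegral _ _

end L1Dist

/-! ### Almost periods of a density and the subgroup they form. -/

section Translation

variable {G : Type*} [AddCommGroup G] [TopologicalSpace G] [IsTopologicalAddGroup G]
  [LocallyCompactSpace G] [T2Space G] [SecondCountableTopology G] [MeasurableSpace G]
  [BorelSpace G] {μ : Measure G} [μ.IsAddHaarMeasure]

theorem l1Dist_comp_sub_right (u v : G → ℝ≥0) (t : G) :
    l1Dist μ (fun x => u (x - t)) (fun x => v (x - t)) = l1Dist μ u v :=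
  lintegral_sub_right_eq_self (fun x => edist (u x) (v x)) t

theorem l1Dist_comp_sub_left (u v : G → ℝ≥0) (t : G) :
    l1Dist μ (fun x => u (t - x)) (fun x => v (t - x)) = l1Dist μ u v :=
  lintegral_sub_left_eq_self (fun x => edist (u x) (v x)) t

/-- The modulus of translation `t ↦ ‖E - T^t E‖₁`. -/
noncomputable def translationModulus (μ : Measure G) (E : G → ℝ≥0) (t : G) : ℝ≥0∞ :=
  l1Dist μ E (fun x => E (x - t))

theorem translationModulus_zero (E : G → ℝ≥0) : translationModulus μ E 0 = 0 := by
  simp [translationModulus, l1Dist_self]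

theorem translationModulus_neg (E : G → ℝ≥0) (t : G) :
    translationModulus μ E (-t) = translationModulus μ E t := by
  rw [translationModulus, ← l1Dist_comp_sub_right _ _ t, l1Dist_comm]
  simp [translationModulus]

theorem translationModulus_add {E : G → ℝ≥0} (hE : Measurable E) (s t : G) :
    translationModulus μ E (s + t) ≤ translationModulus μ E s + translationModulus μ E t := by
  have h : translationModulus μ E t =
      l1Dist μ (fun x => E (x - s)) (fun x => E (x - (s + t))) := by
    rw [translationModulus, ← l1Dist_comp_sub_right _ _ s]
    simp [sub_sub]
  rw [h]
  exact l1Dist_triangle _ hE (by fun_prop)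

theorem measurable_translationModulus {E : G → ℝ≥0} (hE : Measurable E) :
    Measurable (translationModulus μ E) := by
  unfold translationModulus l1Dist
  refine Measurable.lintegral_prod_right' (f := fun z : G × G => edist (E z.2) (E (z.2 - z.1))) ?_
  exact (hE.comp measurable_snd).edist (hE.comp (measurable_snd.sub measurable_fst))

/-- A set carrying most of the mass of `E` meets its translates by the almost periods of `E`. -/
theorem exists_mem_add_mem {E : G → ℝ≥0} (hE : Measurable E)
    (hE1 : ∫⁻ x, (E x : ℝ≥0∞) ∂μ = 1) {S : Set G} (hS : MeasurableSet S) {t : G} {a b : ℝ≥0∞}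
    (ha : ∫⁻ x in Sᶜ, (E x : ℝ≥0∞) ∂μ ≤ a) (hb : translationModulus μ E t ≤ b)
    (h : a + (a + b) < 1) : ∃ x ∈ S, x + t ∈ S := by
  by_contra! hcon
  have key : (1 : ℝ≥0∞) ≤ a + (a + b) := by
    -- If no point of S were moved into S, all the mass of E would lie off S (at most a) or be moved
    -- off S by t (at most a + b).
    have hcov : (Set.univ : Set G) ⊆ Sᶜ ∪ (fun x => x + t) ⁻¹' Sᶜ := by
      intro x _
      by_cases hx : x ∈ S
      · exact Or.inr (hcon x hx)
      · exact Or.inl hx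
    have htr : ∫⁻ x in (fun x => x + t) ⁻¹' Sᶜ, (E x : ℝ≥0∞) ∂μ
        = ∫⁻ x in Sᶜ, (E (x - t) : ℝ≥0∞) ∂μ := by
      rw [← lintegral_indicator (hS.compl.preimage (measurable_add_const t)),
        ← lintegral_indicator hS.compl,
        ← lintegral_add_right_eq_self (Sᶜ.indicator fun x => (E (x - t) : ℝ≥0∞)) t]
      refine lintegral_congr fun x => ?_
      simp only [Set.indicator, Set.mem_preimage, add_sub_cancel_right]
      rfl
    calc (1 : ℝ≥0∞) = ∫⁻ x in Set.univ, (E x : ℝ≥0∞) ∂μ := by rw [setLIntegral_univ, hE1]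
      _ ≤ ∫⁻ x in Sᶜ ∪ (fun x => x + t) ⁻¹' Sᶜ, (E x : ℝ≥0∞) ∂μ := lintegral_mono_set hcov
      _ ≤ ∫⁻ x in Sᶜ, (E x : ℝ≥0∞) ∂μ + ∫⁻ x in (fun x => x + t) ⁻¹' Sᶜ, (E x : ℝ≥0∞) ∂μ :=
        lintegral_union_le _ _ _
      _ ≤ a + (a + b) := by
        rw [htr]
        gcongr
        refine (setLIntegral_le_add_l1Dist hE _).trans ?_
        gcongr
        rw [l1Dist_comm]
        exact hb
  exact absurd key (not_le.2 h)

/-- The subgroup of almost periods of `E`, under a gap hypothesis. -/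
def almostPeriods (μ : Measure G) [μ.IsAddHaarMeasure] {E : G → ℝ≥0} (hE : Measurable E) (δ : ℝ≥0∞)
    (hgap : ∀ t, translationModulus μ E t ≤ δ + δ → translationModulus μ E t ≤ δ) :
    AddSubgroup G where
  carrier := {t | translationModulus μ E t ≤ δ}
  zero_mem' := by simp [translationModulus_zero]
  add_mem' := fun {s t} hs ht =>
    hgap _ ((translationModulus_add hE s t).trans (add_le_add hs ht))
  neg_mem' := fun {t} ht => by simpa [translationModulus_neg] using ht

/-- Markov's inequality for the translation modulus, under the measure with density E. -/
theorem setLIntegral_compl_le_of_lintegral_mul_le {E : G → ℝ≥0} (hE : Measurable E) {η : ℝ≥0}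
    (hη : 0 < η) (h : ∫⁻ t, E t * translationModulus μ E t ∂μ ≤ η * η) :
    ∫⁻ t in {t | translationModulus μ E t ≤ η}ᶜ, (E t : ℝ≥0∞) ∂μ ≤ η := by
  have hη0 : (η : ℝ≥0∞) ≠ 0 := by simpa using hη.ne'
  have hK : MeasurableSet {t | translationModulus μ E t ≤ η} :=
    measurable_translationModulus hE measurableSet_Iic
  refine (ENNReal.mul_le_mul_iff_right hη0 ENNReal.coe_ne_top).1 (le_trans ?_ h)
  rw [← lintegral_const_mul _ hE.coe_nnreal_ennreal]
  refine le_trans ?_ (setLIntegral_le_lintegral {t | translationModulus μ E t ≤ η}ᶜ _)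
  refine setLIntegral_mono' hK.compl fun t ht => ?_
  rw [mul_comm]
  gcongr
  exact (not_le.1 (mt Set.mem_ofPred.2 ht)).le

/-- The modulus takes no value in (2η, 4η]. The set K where it is at most η carries mass at least 1
- η, so a t with modulus at most 4η moves some x ∈ K into K (6η < 1). Then t = (x + t) - x is a
difference of two points of K, and subadditivity gives 2η. -/
theorem translationModulus_gap {E : G → ℝ≥0} (hE : Measurable E)
    (hE1 : ∫⁻ x, (E x : ℝ≥0∞) ∂μ = 1) {η : ℝ≥0} (hη1 : η ≤ 1 / 16)
    (hK : ∫⁻ t in {t | translationModulus μ E t ≤ η}ᶜ, (E t : ℝ≥0∞) ∂μ ≤ η) (t : G)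
    (ht : translationModulus μ E t ≤ ((2 * η : ℝ≥0) : ℝ≥0∞) + ((2 * η : ℝ≥0) : ℝ≥0∞)) :
    translationModulus μ E t ≤ ((2 * η : ℝ≥0) : ℝ≥0∞) := by
  obtain ⟨x, hx, hxt⟩ := exists_mem_add_mem hE hE1
    (measurable_translationModulus hE measurableSet_Iic) hK ht (by
      norm_cast
      rw [← NNReal.coe_lt_coe]
      have : (η : ℝ) ≤ 1 / 16 := by exact_mod_cast hη1
      push_cast
      linarith)
  have h := translationModulus_add (μ := μ) hE (x + t) (-x)
  rw [translationModulus_neg, add_neg_cancel_comm] at h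
  refine h.trans ((add_le_add hxt hx).trans ?_)
  norm_cast
  rw [two_mul]

/-- A compact L carries mass at least 7/8 of E. Each t ∈ H moves some point of L into L, since 1/8 +
1/8 + 1/2 < 1, so H is a closed subset of L - L. -/
theorem isCompact_of_translationModulus_le {E : G → ℝ≥0} (hE : Measurable E)
    (hE1 : ∫⁻ x, (E x : ℝ≥0∞) ∂μ = 1) {H : Set G} (hH : IsClosed H)
    (hHE : ∀ t ∈ H, translationModulus μ E t ≤ 1 / 2) : IsCompact H := by
  obtain ⟨n, hn⟩ : ∃ n, ∫⁻ x in (compactCovering G n)ᶜ, (E x : ℝ≥0∞) ∂μ ≤ 1 / 8 := by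
    have hlim := tendsto_measure_iInter_atTop
      (μ := μ.withDensity fun x => (E x : ℝ≥0∞)) (s := fun n => (compactCovering G n)ᶜ)
      (fun n => ((isCompact_compactCovering G n).measurableSet.compl).nullMeasurableSet)
      (fun m n hmn => Set.compl_subset_compl.2 (compactCovering_subset G hmn))
      ⟨0, by
        rw [withDensity_apply _ (isCompact_compactCovering G 0).measurableSet.compl]
        refine ((setLIntegral_le_lintegral _ _).trans_lt ?_).ne
        rw [hE1]
        exact ENNReal.one_lt_top⟩
    rw [← Set.compl_iUnion, iUnion_compactCovering, Set.compl_univ, measure_empty] at hlim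
    obtain ⟨n, hn⟩ := (hlim.eventually_le_const (u := 1 / 8) (by simp)).exists
    rw [Function.comp_apply,
      withDensity_apply _ (isCompact_compactCovering G n).measurableSet.compl] at hn
    exact ⟨n, hn⟩
  have hL := isCompact_compactCovering G n
  refine (hL.add hL.neg).of_isClosed_subset hH fun t ht => ?_
  obtain ⟨x, hx, hxt⟩ := exists_mem_add_mem hE hE1 hL.measurableSet hn (hHE t ht) (by
    rw [← ENNReal.toReal_lt_toReal (by finiteness) (by finiteness)]
    rw [ENNReal.toReal_add (by finiteness) (by finiteness),
      ENNReal.toReal_add (by finiteness) (by finiteness)]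
    norm_num)
  exact ⟨x + t, hxt, -x, by simpa using hx, by simp [add_comm]⟩

/-- H consists of the t with modulus at most 2η. It carries mass at least 1 - η, so it has positive
measure and is open by Steinhaus. Averaging over H shows that E is nearly constant there, and total
mass 1 forces the constant to be near 1/μ(H). The errors are 2η (oscillation on H), 3η (the
constant) and η (mass off H). -/
theorem exists_addSubgroup_l1Dist_le {E : G → ℝ≥0} (hE : Measurable E)
    (hE1 : ∫⁻ x, (E x : ℝ≥0∞) ∂μ = 1) {η : ℝ≥0} (hη : 0 < η) (hη1 : η ≤ 1 / 16)
    (h : ∫⁻ t, E t * translationModulus μ E t ∂μ ≤ η * η) :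
    ∃ H : AddSubgroup G, IsCompact (H : Set G) ∧ IsOpen (H : Set G) ∧
      l1Dist μ E ((H : Set G).indicator fun _ => (μ H).toNNReal⁻¹) ≤ (6 * η : ℝ≥0) := by
  have hK := setLIntegral_compl_le_of_lintegral_mul_le hE hη h
  have hη1' : (η : ℝ) ≤ 1 / 16 := by exact_mod_cast hη1
  let H : AddSubgroup G := almostPeriods μ hE _ (translationModulus_gap hE hE1 hη1 hK)
  have hHm : MeasurableSet (H : Set G) := measurable_translationModulus hE measurableSet_Iic
  have hHc : ∫⁻ t in (H : Set G)ᶜ, (E t : ℝ≥0∞) ∂μ ≤ η := by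
    refine le_trans (lintegral_mono_set (Set.compl_subset_compl.2 fun t ht => ?_)) hK
    refine le_trans (Set.mem_ofPred.1 ht) ?_
    norm_cast
    rw [two_mul]
    exact le_self_add
  have hsplit := lintegral_add_compl (μ := μ) (fun x => (E x : ℝ≥0∞)) hHm
  rw [hE1] at hsplit
  have hHpos : 0 < μ (H : Set G) := by
    refine pos_iff_ne_zero.2 fun h0 => ?_
    rw [Measure.restrict_eq_zero.2 h0, lintegral_zero_measure, zero_add] at hsplit
    rw [hsplit] at hHc
    have : (1 : ℝ) ≤ η := by exact_mod_cast hHc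
    linarith
  have hopen : IsOpen (H : Set G) := by
    refine H.isOpen_of_mem_nhds (g := 0) ?_
    refine mem_of_superset (Measure.sub_mem_nhds_zero_of_addHaar_pos μ _ hHm hHpos) ?_
    rintro _ ⟨x, hx, y, hy, rfl⟩
    exact H.sub_mem hx hy
  have hcomp : IsCompact (H : Set G) := by
    refine isCompact_of_translationModulus_le hE hE1 (H.isClosed_of_isOpen hopen) fun t ht => ?_
    refine le_trans (Set.mem_ofPred.1 ht) ?_
    rw [ENNReal.le_div_iff_mul_le (by simp) (by simp)]
    norm_cast
    rw [← NNReal.coe_le_coe]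
    push_cast
    linarith
  refine ⟨H, hcomp, hopen, ?_⟩
  have hM0 : μ (H : Set G) ≠ 0 := hHpos.ne'
  have hMt : μ (H : Set G) ≠ ∞ := hcomp.measure_lt_top.ne
  -- the value of `E` at a typical point of `H`
  obtain ⟨y, hyH, hy⟩ : ∃ y ∈ (H : Set G),
      ∫⁻ x in (H : Set G), edist (E x) (E y) ∂μ ≤ (2 * η : ℝ≥0) := by
    -- Average over y ∈ H. The substitution y = x - t preserves H and turns the double integral into
    -- an average of translation moduli over t ∈ H, each at most 2η.
    by_contra! hcon
    have h1 : ((2 * η : ℝ≥0) : ℝ≥0∞) * μ (H : Set G) <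
        ∫⁻ y in (H : Set G), ∫⁻ x in (H : Set G), edist (E x) (E y) ∂μ ∂μ := by
      rw [← setLIntegral_const]
      refine setLIntegral_strict_mono hHm hM0 ?_ ?_ ?_
      · refine Measurable.lintegral_prod_right' (f := fun z : G × G => edist (E z.2) (E z.1)) ?_
        exact (hE.comp measurable_snd).edist (hE.comp measurable_fst)
      · rw [setLIntegral_const]
        exact ENNReal.mul_ne_top ENNReal.coe_ne_top hMt
      · exact ae_of_all _ hcon
    refine absurd h1 (not_lt.2 ?_)
    rw [lintegral_lintegral_swap (by
      refine Measurable.aemeasurable ?_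
      exact (hE.comp measurable_snd).edist (hE.comp measurable_fst))]
    calc ∫⁻ x in (H : Set G), ∫⁻ y in (H : Set G), edist (E x) (E y) ∂μ ∂μ
        ≤ ∫⁻ x in (H : Set G), ∫⁻ t in (H : Set G), edist (E x) (E (x - t)) ∂μ ∂μ := by
          refine setLIntegral_mono' hHm fun x hx => le_of_eq ?_
          rw [← lintegral_indicator hHm, ← lintegral_indicator hHm,
            ← lintegral_sub_left_eq_self _ x]
          refine lintegral_congr fun t => ?_
          have hiff : x - t ∈ (H : Set G) ↔ t ∈ (H : Set G) :=
            ⟨fun hxt => by simpa using H.sub_mem hx hxt, fun ht => H.sub_mem hx ht⟩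
          by_cases ht : t ∈ (H : Set G)
          · rw [Set.indicator_of_mem (hiff.2 ht), Set.indicator_of_mem ht]
          · rw [Set.indicator_of_notMem (mt hiff.1 ht), Set.indicator_of_notMem ht]
      _ = ∫⁻ t in (H : Set G), ∫⁻ x in (H : Set G), edist (E x) (E (x - t)) ∂μ ∂μ := by
          refine lintegral_lintegral_swap (Measurable.aemeasurable ?_)
          exact (hE.comp measurable_fst).edist (hE.comp (measurable_fst.sub measurable_snd))
      _ ≤ ∫⁻ _ in (H : Set G), ((2 * η : ℝ≥0) : ℝ≥0∞) ∂μ := by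
          refine setLIntegral_mono' hHm fun t ht => ?_
          exact (setLIntegral_le_lintegral _ _).trans ht
      _ = _ := setLIntegral_const _ _
  lift μ (H : Set G) to ℝ≥0 using hMt with M hM
  rw [ENNReal.toNNReal_coe]
  have hM0' : M ≠ 0 := by simpa using hM0
  have hv1 : (E y : ℝ≥0∞) * M ≤ 1 + (2 * η : ℝ≥0) := by
    rw [hM, ← setLIntegral_const]
    calc ∫⁻ _ in (H : Set G), (E y : ℝ≥0∞) ∂μ
        ≤ ∫⁻ x in (H : Set G), ((E x : ℝ≥0∞) + edist (E x) (E y)) ∂μ :=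
          lintegral_mono fun x => by
            rw [edist_comm]; exact NNReal.coe_le_add_edist _ _
      _ ≤ _ := by
        rw [lintegral_add_left hE.coe_nnreal_ennreal]
        gcongr
        rw [← hsplit]
        exact le_self_add
  have hv2 : (1 : ℝ≥0∞) ≤ E y * M + (2 * η : ℝ≥0) + η := by
    rw [← hsplit]
    gcongr
    rw [hM, ← setLIntegral_const]
    calc ∫⁻ x in (H : Set G), (E x : ℝ≥0∞) ∂μ
        ≤ ∫⁻ x in (H : Set G), ((E y : ℝ≥0∞) + edist (E x) (E y)) ∂μ :=
          lintegral_mono fun x => NNReal.coe_le_add_edist _ _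
      _ ≤ _ := by
        rw [lintegral_add_left measurable_const]
        gcongr
  have hv : edist (E y) M⁻¹ * M ≤ (3 * η : ℝ≥0) := by
    have : edist (E y) M⁻¹ ≤ ((3 * η / M : ℝ≥0) : ℝ≥0∞) := by
      norm_cast at hv1 hv2
      have hMp : 0 < M := pos_iff_ne_zero.2 hM0'
      refine NNReal.edist_le_of_le_add ?_ ?_
      · norm_cast
        rw [inv_eq_one_div, ← add_div, le_div_iff₀ hMp]
        refine hv1.trans ?_
        gcongr
        norm_num
      · norm_cast
        rw [inv_eq_one_div, div_le_iff₀ hMp, add_mul, div_mul_cancel₀ _ hM0']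
        refine hv2.trans (le_of_eq ?_)
        ring
    refine (mul_le_mul_left this _).trans (le_of_eq ?_)
    norm_cast
    rw [div_mul_cancel₀ _ hM0']
  rw [l1Dist, ← lintegral_add_compl _ hHm]
  have hin : ∫⁻ x in (H : Set G), edist (E x) ((H : Set G).indicator (fun _ => M⁻¹) x) ∂μ
      ≤ (2 * η : ℝ≥0) + (3 * η : ℝ≥0) := by
    calc ∫⁻ x in (H : Set G), edist (E x) ((H : Set G).indicator (fun _ => M⁻¹) x) ∂μ
        ≤ ∫⁻ x in (H : Set G), (edist (E x) (E y) + edist (E y) M⁻¹) ∂μ := by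
          refine setLIntegral_mono' hHm fun x hx => ?_
          rw [Set.indicator_of_mem hx]
          exact edist_triangle _ _ _
      _ ≤ _ := by
          rw [lintegral_add_right _ measurable_const, setLIntegral_const, ← hM]
          gcongr
  have hout : ∫⁻ x in (H : Set G)ᶜ, edist (E x) ((H : Set G).indicator (fun _ => M⁻¹) x) ∂μ
      ≤ η := by
    refine le_trans (setLIntegral_mono' hHm.compl fun x hx => ?_) hHc
    rw [Set.indicator_of_notMem hx]
    simpa only [ENNReal.coe_zero, add_zero] using NNReal.edist_le_add (E x) 0
  refine (add_le_add hin hout).trans (le_of_eq ?_)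
  norm_cast
  ring

end Translation

/-! ### Stability of Hölder's inequality. -/

/-- The weighted arithmetic-geometric mean inequality with a remainder term. -/
theorem Real.geom_mean_add_sq_sqrt_sub_le {u v w α β γ m : ℝ} (hu : 0 ≤ u) (hv : 0 ≤ v)
    (hw : 0 ≤ w) (hγ : 0 ≤ γ) (hm : 0 ≤ m) (hmα : m ≤ α) (hmβ : m ≤ β) (hsum : α + β + γ = 1) :
    u ^ α * v ^ β * w ^ γ + m * (√u - √v) ^ 2 ≤ α * u + β * v + γ * w := by
  -- Moving weight m from each of u and v to √u√v keeps the geometric mean and lowers the arithmetic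
  -- mean by exactly m(√u - √v)².
  have h := Real.geom_mean_le_arith_mean4_weighted (w₁ := 2 * m) (w₂ := α - m) (w₃ := β - m)
    (w₄ := γ) (p₁ := √u * √v) (by positivity) (by linarith) (by linarith) hγ (by positivity)
    hu hv hw (by linarith)
  have hpow : ∀ t : ℝ, 0 ≤ t → √t ^ (2 * m) = t ^ m := fun t ht => by
    rw [Real.sqrt_eq_rpow, ← Real.rpow_mul ht]
    congr 1
    ring
  have hu' : u ^ m * u ^ (α - m) = u ^ α := by
    rw [← Real.rpow_add_of_nonneg hu hm (by linarith), add_sub_cancel]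
  have hv' : v ^ m * v ^ (β - m) = v ^ β := by
    rw [← Real.rpow_add_of_nonneg hv hm (by linarith), add_sub_cancel]
  rw [Real.mul_rpow (by positivity) (by positivity), hpow u hu, hpow v hv] at h
  rw [← hu', ← hv']
  nlinarith [Real.sq_sqrt hu, Real.sq_sqrt hv]

/-- Factor u - v = (√u - √v)(√u + √v) and split the product with parameter l. This trades the
Hellinger-type remainder for an L¹ distance. -/
theorem Real.mul_abs_sub_le_sq_sqrt_sub_add {u v : ℝ} (l : ℝ) (hu : 0 ≤ u) (hv : 0 ≤ v) :
    l * |u - v| ≤ (√u - √v) ^ 2 + l ^ 2 * (u + v) := by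
  have h : u - v = (√u - √v) * (√u + √v) := by
    nlinarith [Real.sq_sqrt hu, Real.sq_sqrt hv]
  rw [h, abs_mul, abs_of_nonneg (a := √u + √v) (by positivity), ← sq_abs (√u - √v)]
  have h2 : u + v = √u ^ 2 + √v ^ 2 := by rw [Real.sq_sqrt hu, Real.sq_sqrt hv]
  rw [h2]
  nlinarith [sq_nonneg (|√u - √v| - l * (√u + √v) / 2), mul_nonneg (sq_nonneg l)
    (sq_nonneg (√u - √v)), mul_nonneg (sq_nonneg l) (sq_nonneg (√u + √v))]

theorem ENNReal.geom_mean_add_edist_le (u v w : ℝ≥0) {α β γ m l : ℝ≥0} (hmα : m ≤ α)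
    (hmβ : m ≤ β) (hsum : α + β + γ = 1) :
    (u : ℝ≥0∞) ^ (α : ℝ) * (v : ℝ≥0∞) ^ (β : ℝ) * (w : ℝ≥0∞) ^ (γ : ℝ) + (m * l) * edist u v ≤
      α * u + β * v + γ * w + (m * l ^ 2) * (u + v) := by
  rw [edist_nndist, ← ENNReal.coe_rpow_of_nonneg _ α.coe_nonneg,
    ← ENNReal.coe_rpow_of_nonneg _ β.coe_nonneg, ← ENNReal.coe_rpow_of_nonneg _ γ.coe_nonneg]
  norm_cast
  rw [← NNReal.coe_le_coe]
  push_cast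
  rw [NNReal.dist_eq]
  have h1 := Real.geom_mean_add_sq_sqrt_sub_le u.coe_nonneg v.coe_nonneg w.coe_nonneg
    γ.coe_nonneg m.coe_nonneg (NNReal.coe_le_coe.2 hmα) (NNReal.coe_le_coe.2 hmβ)
    (by exact_mod_cast hsum)
  have h2 := mul_le_mul_of_nonneg_left
    (Real.mul_abs_sub_le_sq_sqrt_sub_add (l : ℝ) u.coe_nonneg v.coe_nonneg) m.coe_nonneg
  linarith

/-- Near equality in Hölder's inequality for three functions of integral one forces the first two
functions to be close in `L¹`. -/
theorem l1Dist_le_of_le_lintegral_geom_mean {X : Type*} [MeasurableSpace X] {ν : Measure X}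
    {u v w : X → ℝ≥0} (hu : Measurable u) (hv : Measurable v) (hw : Measurable w)
    (hu1 : ∫⁻ x, (u x : ℝ≥0∞) ∂ν = 1) (hv1 : ∫⁻ x, (v x : ℝ≥0∞) ∂ν = 1)
    (hw1 : ∫⁻ x, (w x : ℝ≥0∞) ∂ν = 1) {α β γ m l : ℝ≥0} (hm : 0 < m) (hl : 0 < l) (hmα : m ≤ α)
    (hmβ : m ≤ β) (hsum : α + β + γ = 1)
    (h : 1 ≤ ∫⁻ x, (u x : ℝ≥0∞) ^ (α : ℝ) * (v x : ℝ≥0∞) ^ (β : ℝ) * (w x : ℝ≥0∞) ^ (γ : ℝ) ∂ν +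
      (m * l ^ 2 : ℝ≥0)) :
    l1Dist ν u v ≤ (3 * l : ℝ≥0) := by
  have key : ∫⁻ x, (u x : ℝ≥0∞) ^ (α : ℝ) * (v x : ℝ≥0∞) ^ (β : ℝ) * (w x : ℝ≥0∞) ^ (γ : ℝ) ∂ν +
      (m * l) * l1Dist ν u v ≤ 1 + m * l ^ 2 * 2 := by
    rw [l1Dist, ← lintegral_const_mul _ (hu.edist hv), ← lintegral_add_left (by fun_prop)]
    refine (lintegral_mono fun x =>
      ENNReal.geom_mean_add_edist_le (u x) (v x) (w x) hmα hmβ hsum).trans (le_of_eq ?_)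
    rw [lintegral_add_left (by fun_prop), lintegral_add_left (by fun_prop),
      lintegral_add_left (by fun_prop), lintegral_const_mul _ (by fun_prop),
      lintegral_const_mul _ (by fun_prop), lintegral_const_mul _ (by fun_prop),
      lintegral_const_mul _ (by fun_prop), lintegral_add_left (by fun_prop), hu1, hv1, hw1,
      mul_one, mul_one, mul_one, one_add_one_eq_two]
    norm_cast
    rw [hsum]
  -- The error 2ml² of the pointwise inequality and the deficit ml² of the hypothesis add up to
  -- 3ml²; dividing by ml leaves 3l.
  have key2 : 1 + (m * l) * l1Dist ν u v ≤ 1 + (m * l) * (3 * l : ℝ≥0) := by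
    calc 1 + (m * l) * l1Dist ν u v ≤ _ := add_le_add_left h _
      _ = (∫⁻ x, (u x : ℝ≥0∞) ^ (α : ℝ) * (v x : ℝ≥0∞) ^ (β : ℝ) * (w x : ℝ≥0∞) ^ (γ : ℝ) ∂ν +
          (m * l) * l1Dist ν u v) + (m * l ^ 2 : ℝ≥0) := add_right_comm _ _ _
      _ ≤ (1 + m * l ^ 2 * 2) + (m * l ^ 2 : ℝ≥0) := add_le_add_left key _
      _ = _ := by norm_cast; ring_nf
  have hml : (m : ℝ≥0∞) * l ≠ 0 := by
    simpa using ⟨hm.ne', hl.ne'⟩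
  exact (ENNReal.mul_le_mul_iff_right hml (by finiteness)).1
    ((ENNReal.add_le_add_iff_left ENNReal.one_ne_top).1 key2)

theorem NNReal.edist_mul_left (a b c : ℝ≥0) : edist (a * b) (a * c) = (a : ℝ≥0∞) * edist b c := by
  simp only [edist_nndist, NNReal.nndist_eq]
  norm_cast
  rw [← mul_tsub, ← mul_tsub, mul_max]

/-- Some value does not exceed the mean under the probability measure with density u. This picks one
good translate out of an averaged bound. -/
theorem exists_le_of_lintegral_mul_le {X : Type*} [MeasurableSpace X] {μ : Measure X}
    {u : X → ℝ≥0} (hu : Measurable u) (hu1 : ∫⁻ x, (u x : ℝ≥0∞) ∂μ = 1) {φ : X → ℝ≥0∞}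
    (hφ : Measurable φ) {δ : ℝ≥0∞} (h : ∫⁻ x, u x * φ x ∂μ ≤ δ) : ∃ x, φ x ≤ δ := by
  have : IsProbabilityMeasure (μ.withDensity fun x => (u x : ℝ≥0∞)) :=
    ⟨by rw [withDensity_apply _ MeasurableSet.univ, setLIntegral_univ, hu1]⟩
  obtain ⟨x, hx⟩ := exists_le_lintegral (μ := μ.withDensity fun x => (u x : ℝ≥0∞))
    hφ.aemeasurable
  refine ⟨x, hx.trans ?_⟩
  rw [lintegral_withDensity_eq_lintegral_mul _ hu.coe_nnreal_ennreal hφ]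
  exact h

/-! ### Near equality in Young's inequality for densities. -/

section Young

variable {G : Type*} [AddCommGroup G] [TopologicalSpace G] [IsTopologicalAddGroup G]
  [LocallyCompactSpace G] [T2Space G] [SecondCountableTopology G] [MeasurableSpace G]
  [BorelSpace G] {μ : Measure G} [μ.IsAddHaarMeasure]

/-- The pointwise bound behind Young's inequality. -/
theorem lintegral_rpow_mul_rpow_le {A B : G → ℝ≥0} (hA : Measurable A) (hB : Measurable B)
    (hA1 : ∫⁻ x, (A x : ℝ≥0∞) ∂μ = 1) (hB1 : ∫⁻ x, (B x : ℝ≥0∞) ∂μ = 1) {σ α β : ℝ≥0}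
    (hsum : σ + α + β = 1) (h : G) :
    ∫⁻ x, (A (x - h) : ℝ≥0∞) ^ ((σ + α : ℝ≥0) : ℝ) * (B x : ℝ≥0∞) ^ ((σ + β : ℝ≥0) : ℝ) ∂μ ≤
      (∫⁻ x, (A (x - h) : ℝ≥0∞) * B x ∂μ) ^ (σ : ℝ) := by
  -- Hölder with exponents σ, α, β on A(x-h)B(x), A(x-h) and B(x); the last two have integral 1.
  have hH := ENNReal.lintegral_prod_norm_pow_le (μ := μ) (Finset.univ : Finset (Fin 3))
    (f := ![fun x => (A (x - h) : ℝ≥0∞) * B x, fun x => (A (x - h) : ℝ≥0∞),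
      fun x => (B x : ℝ≥0∞)]) (p := ![σ, α, β])
    (by
      intro i _
      fin_cases i
      · exact Measurable.aemeasurable (by simp; fun_prop)
      · exact Measurable.aemeasurable (by simp; fun_prop)
      · exact Measurable.aemeasurable (by simp; fun_prop))
    (by simpa [Fin.sum_univ_three] using congrArg NNReal.toReal hsum)
    (by intro i _; fin_cases i <;> simp)
  simp only [Fin.prod_univ_three, Matrix.cons_val] at hH
  rw [lintegral_sub_right_eq_self (fun x => (A x : ℝ≥0∞)) h, hA1, hB1, ENNReal.one_rpow,
    ENNReal.one_rpow, mul_one, mul_one] at hH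
  refine le_trans (le_of_eq (lintegral_congr fun x => ?_)) hH
  rw [ENNReal.mul_rpow_of_nonneg _ _ σ.coe_nonneg, NNReal.coe_add, NNReal.coe_add,
    ENNReal.rpow_add_of_nonneg _ _ σ.coe_nonneg α.coe_nonneg,
    ENNReal.rpow_add_of_nonneg _ _ σ.coe_nonneg β.coe_nonneg]
  ring

/-- Near equality in Young's inequality, for densities `A` and `B`: most translates of `A` by
reflected points agree with a density `C`, and so do most translates of `B`. -/
theorem exists_density_of_young {A B : G → ℝ≥0} (hA : Measurable A) (hB : Measurable B)
    (hA1 : ∫⁻ x, (A x : ℝ≥0∞) ∂μ = 1) (hB1 : ∫⁻ x, (B x : ℝ≥0∞) ∂μ = 1) {σ α β m l : ℝ≥0}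
    (hm : 0 < m) (hl : 0 < l) (hmσ : m ≤ σ) (hmα : m ≤ α) (hmβ : m ≤ β) (hsum : σ + α + β = 1)
    (h : 1 ≤ ∫⁻ h, (∫⁻ x, (A (x - h) : ℝ≥0∞) ^ ((σ + α : ℝ≥0) : ℝ) *
      (B x : ℝ≥0∞) ^ ((σ + β : ℝ≥0) : ℝ) ∂μ) ^ (1 / (σ : ℝ)) ∂μ + (m * l ^ 2 : ℝ≥0)) :
    ∃ C : G → ℝ≥0, Measurable C ∧
      ∫⁻ y, A y * l1Dist μ B (fun x => C (x - y)) ∂μ ≤ (3 * l : ℝ≥0) ∧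
      ∫⁻ x, B x * l1Dist μ (fun z => A (x - z)) C ∂μ ≤ (3 * l : ℝ≥0) := by
  set D : G → ℝ≥0∞ := fun h => ∫⁻ x, (A (x - h) : ℝ≥0∞) * B x ∂μ with hD
  have hm2 : Measurable fun z : G × G => A (z.2 - z.1) :=
    hA.comp (measurable_snd.sub measurable_fst)
  have hDm : Measurable D := Measurable.lintegral_prod_right'
    (f := fun z : G × G => (A (z.2 - z.1) : ℝ≥0∞) * B z.2) (by fun_prop)
  have hD1 : ∫⁻ h, D h ∂μ = 1 := by
    rw [hD, lintegral_lintegral_swap (Measurable.aemeasurable (by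
      change Measurable fun z : G × G => (A (z.2 - z.1) : ℝ≥0∞) * B z.2
      fun_prop))]
    rw [← hB1]
    refine lintegral_congr fun x => ?_
    rw [lintegral_mul_const _ (by fun_prop),
      lintegral_sub_left_eq_self (fun y => (A y : ℝ≥0∞)) x, hA1, one_mul]
  -- `toNNReal` sends ∞ to 0, which changes D only on a null set because D has integral 1.
  let C : G → ℝ≥0 := fun h => (D h).toNNReal
  have hC : Measurable C := hDm.ennreal_toNNReal
  have hCD : ∀ᵐ h ∂μ, (C h : ℝ≥0∞) = D h := by
    filter_upwards [ae_lt_top hDm (by rw [hD1]; exact ENNReal.one_ne_top)] with h hh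
    exact ENNReal.coe_toNNReal hh.ne
  have hC1 : ∫⁻ h, (C h : ℝ≥0∞) ∂μ = 1 := by rw [lintegral_congr_ae hCD, hD1]
  let u : G × G → ℝ≥0 := fun z => A (z.2 - z.1) * B z.2
  let v : G × G → ℝ≥0 := fun z => A (z.2 - z.1) * C z.1
  let w : G × G → ℝ≥0 := fun z => B z.2 * C z.1
  have hu : Measurable u := by fun_prop
  have hv : Measurable v := by fun_prop
  have hw : Measurable w := by fun_prop
  have hu1 : ∫⁻ z, (u z : ℝ≥0∞) ∂(μ.prod μ) = 1 := by
    rw [lintegral_prod _ hu.coe_nnreal_ennreal.aemeasurable, ← hD1]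
    simp only [u, ENNReal.coe_mul, hD]
  have hv1 : ∫⁻ z, (v z : ℝ≥0∞) ∂(μ.prod μ) = 1 := by
    rw [lintegral_prod _ hv.coe_nnreal_ennreal.aemeasurable, ← hC1]
    refine lintegral_congr fun h => ?_
    simp only [v, ENNReal.coe_mul]
    rw [lintegral_mul_const _ (by fun_prop),
      lintegral_sub_right_eq_self (fun y => (A y : ℝ≥0∞)) h, hA1, one_mul]
  have hw1 : ∫⁻ z, (w z : ℝ≥0∞) ∂(μ.prod μ) = 1 := by
    rw [lintegral_prod _ hw.coe_nnreal_ennreal.aemeasurable, ← hC1]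
    refine lintegral_congr fun h => ?_
    simp only [w, ENNReal.coe_mul]
    rw [lintegral_mul_const _ (by fun_prop), hB1, one_mul]
  have hσ : 0 < (σ : ℝ) := by exact_mod_cast hm.trans_le hmσ
  have hgm : ∫⁻ h, (∫⁻ x, (A (x - h) : ℝ≥0∞) ^ ((σ + α : ℝ≥0) : ℝ) *
      (B x : ℝ≥0∞) ^ ((σ + β : ℝ≥0) : ℝ) ∂μ) ^ (1 / (σ : ℝ)) ∂μ ≤
      ∫⁻ z, (u z : ℝ≥0∞) ^ (σ : ℝ) * (v z : ℝ≥0∞) ^ (α : ℝ) * (w z : ℝ≥0∞) ^ (β : ℝ)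
        ∂(μ.prod μ) := by
    rw [lintegral_prod _ (Measurable.aemeasurable (by fun_prop))]
    refine lintegral_mono_ae ?_
    filter_upwards [hCD] with h hh
    set K := ∫⁻ x, (A (x - h) : ℝ≥0∞) ^ ((σ + α : ℝ≥0) : ℝ) *
      (B x : ℝ≥0∞) ^ ((σ + β : ℝ≥0) : ℝ) ∂μ with hK
    have hKD : K ≤ C h ^ (σ : ℝ) := by
      rw [hh]; exact lintegral_rpow_mul_rpow_le hA hB hA1 hB1 hsum h
    have hαβ : ((α + β : ℝ≥0) : ℝ) = 1 - σ := by
      have := congrArg NNReal.toReal hsum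
      push_cast at this ⊢
      linarith
    have hσ1 : (σ : ℝ) ≤ 1 := by linarith [(α + β).coe_nonneg]
    have hexp : 1 / (σ : ℝ) = 1 + (1 / (σ : ℝ) - 1) := by ring
    have hexp0 : 0 ≤ 1 / (σ : ℝ) - 1 := by
      rw [sub_nonneg, le_div_iff₀ hσ]; linarith
    -- One factor K is kept as an integral in x. Only the remaining power is bounded through K ≤
    -- C^σ, giving C^(1-σ) = C^(α+β).
    calc K ^ (1 / (σ : ℝ)) = K * K ^ (1 / (σ : ℝ) - 1) := by
          rw [hexp, ENNReal.rpow_add_of_nonneg _ _ zero_le_one hexp0, ENNReal.rpow_one,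
            add_sub_cancel_left]
      _ ≤ K * (C h ^ (σ : ℝ)) ^ (1 / (σ : ℝ) - 1) := by gcongr
      _ = K * C h ^ ((α + β : ℝ≥0) : ℝ) := by
          rw [← ENNReal.rpow_mul, hαβ]
          congr 2
          field_simp
      _ = _ := by
          rw [hK, ← lintegral_mul_const _ (by fun_prop)]
          refine lintegral_congr fun x => ?_
          simp only [u, v, w, ENNReal.coe_mul, NNReal.coe_add]
          rw [ENNReal.mul_rpow_of_nonneg _ _ σ.coe_nonneg,
            ENNReal.mul_rpow_of_nonneg _ _ α.coe_nonneg,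
            ENNReal.mul_rpow_of_nonneg _ _ β.coe_nonneg,
            ENNReal.rpow_add_of_nonneg _ _ σ.coe_nonneg α.coe_nonneg,
            ENNReal.rpow_add_of_nonneg _ _ σ.coe_nonneg β.coe_nonneg,
            ENNReal.rpow_add_of_nonneg _ _ α.coe_nonneg β.coe_nonneg]
          ring
  have h' := h.trans (add_le_add_left hgm _)
  -- The densities u and v share the factor A(x-h), and u and w share B(x). Pulling these factors
  -- out gives the two weighted bounds, the first after substituting y = x - h.
  have huv := l1Dist_le_of_le_lintegral_geom_mean hu hv hw hu1 hv1 hw1 hm hl hmσ hmα hsum h'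
  have huw := l1Dist_le_of_le_lintegral_geom_mean hu hw hv hu1 hw1 hv1 hm hl hmσ hmβ
    (by rw [add_right_comm, hsum]) (by simpa only [mul_right_comm] using h')
  refine ⟨C, hC, le_trans (le_of_eq ?_) huv, le_trans (le_of_eq ?_) huw⟩
  · rw [l1Dist, lintegral_prod_symm _ (hu.edist hv).aemeasurable]
    have hL : ∀ y, A y * l1Dist μ B (fun x => C (x - y)) =
        ∫⁻ x, A y * edist (B x) (C (x - y)) ∂μ := fun y => by
      rw [l1Dist, lintegral_const_mul _ (by fun_prop)]
    simp only [hL]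
    rw [lintegral_lintegral_swap (Measurable.aemeasurable (by
      change Measurable fun z : G × G => (A z.1 : ℝ≥0∞) * edist (B z.2) (C (z.2 - z.1))
      fun_prop))]
    refine lintegral_congr fun x => ?_
    rw [← lintegral_sub_left_eq_self _ x]
    refine lintegral_congr fun h => ?_
    simp only [u, v, NNReal.edist_mul_left, sub_sub_cancel]
  · rw [l1Dist, lintegral_prod_symm _ (hu.edist hw).aemeasurable]
    refine lintegral_congr fun x => ?_
    rw [l1Dist, ← lintegral_const_mul _ (by fun_prop)]
    refine lintegral_congr fun h => ?_
    simp only [u, w]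
    rw [mul_comm (A _), NNReal.edist_mul_left]

/-- Densities nearly extremizing Young's inequality are close to coset densities of a common compact
open subgroup. -/
theorem exists_addSubgroup_of_young {A B : G → ℝ≥0} (hA : Measurable A) (hB : Measurable B)
    (hA1 : ∫⁻ x, (A x : ℝ≥0∞) ∂μ = 1) (hB1 : ∫⁻ x, (B x : ℝ≥0∞) ∂μ = 1) {σ α β m l η : ℝ≥0}
    (hm : 0 < m) (hl : 0 < l) (hmσ : m ≤ σ) (hmα : m ≤ α) (hmβ : m ≤ β) (hsum : σ + α + β = 1)
    (hη : 0 < η) (hη1 : η ≤ 1 / 16) (hlη : 12 * l ≤ η * η)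
    (h : 1 ≤ ∫⁻ h, (∫⁻ x, (A (x - h) : ℝ≥0∞) ^ ((σ + α : ℝ≥0) : ℝ) *
      (B x : ℝ≥0∞) ^ ((σ + β : ℝ≥0) : ℝ) ∂μ) ^ (1 / (σ : ℝ)) ∂μ + (m * l ^ 2 : ℝ≥0)) :
    ∃ H : AddSubgroup G, IsCompact (H : Set G) ∧ IsOpen (H : Set G) ∧ ∃ x₀ x₀' : G,
      l1Dist μ A ((x₀ +ᵥ (H : Set G)).indicator fun _ => (μ H).toNNReal⁻¹) ≤ (7 * η : ℝ≥0) ∧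
      l1Dist μ B ((x₀' +ᵥ (H : Set G)).indicator fun _ => (μ H).toNNReal⁻¹) ≤ (7 * η : ℝ≥0) := by
  obtain ⟨C, hC, hAC, hBC⟩ := exists_density_of_young hA hB hA1 hB1 hm hl hmσ hmα hmβ hsum h
  have hφ : Measurable fun y => l1Dist μ B (fun x => C (x - y)) :=
    Measurable.lintegral_prod_right' (f := fun z : G × G => edist (B z.2) (C (z.2 - z.1)))
      (by fun_prop)
  have hψ : Measurable fun x => l1Dist μ (fun z => A (x - z)) C :=
    Measurable.lintegral_prod_right' (f := fun z : G × G => edist (A (z.1 - z.2)) (C z.2))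
      (by fun_prop)
  obtain ⟨y₀, hy₀⟩ := exists_le_of_lintegral_mul_le hA hA1 hφ hAC
  obtain ⟨w₀, hw₀⟩ := exists_le_of_lintegral_mul_le hB hB1 hψ hBC
  let E : G → ℝ≥0 := fun t => A (t + y₀)
  have hE : Measurable E := by fun_prop
  have hE1 : ∫⁻ t, (E t : ℝ≥0∞) ∂μ = 1 := by
    rw [← hA1]; exact lintegral_add_right_eq_self (fun t => (A t : ℝ≥0∞)) y₀
  -- Since C is close to z ↦ A(w₀ - z), this reflection of C is close to E.
  let F : G → ℝ≥0 := fun t => C (w₀ - y₀ - t)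
  have hF : Measurable F := by fun_prop
  have hEF : l1Dist μ E F ≤ (3 * l : ℝ≥0) := by
    refine le_trans (le_of_eq ?_) hw₀
    rw [← l1Dist_comp_sub_left _ _ (w₀ - y₀)]
    congr 1 <;> funext t <;> simp only [E, F] <;> congr 1 <;> abel
  -- Passing from E to F and back costs 3l twice, and F has the same modulus as C. Comparing both
  -- C(· - y₀) and C(· - (t + y₀)) with B costs a third 3l plus the displayed distance.
  have hω : ∀ t, translationModulus μ E t ≤
      (9 * l : ℝ≥0) + l1Dist μ B (fun x => C (x - (t + y₀))) := fun t => by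
    have h1 : translationModulus μ F t = translationModulus μ C t := by
      rw [← translationModulus_neg C, translationModulus, translationModulus,
        ← l1Dist_comp_sub_left C _ (w₀ - y₀)]
      congr 1
      funext x
      simp only [F]
      congr 1
      abel
    have h2 : translationModulus μ C t ≤
        (3 * l : ℝ≥0) + l1Dist μ B (fun x => C (x - (t + y₀))) := by
      rw [translationModulus, ← l1Dist_comp_sub_right _ _ y₀]
      have : (fun x => C (x - y₀ - t)) = fun x => C (x - (t + y₀)) := by
        funext x; congr 1; abel
      rw [this]
      refine (l1Dist_triangle (v := B) _ (by fun_prop) hB).trans ?_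
      gcongr
      rw [l1Dist_comm]
      exact hy₀
    have h3 : translationModulus μ E t ≤
        l1Dist μ E F + (translationModulus μ F t + l1Dist μ F E) := by
      refine (l1Dist_triangle (v := F) _ hE hF).trans ?_
      gcongr
      refine (l1Dist_triangle (v := fun x => F (x - t)) _ hF (by fun_prop)).trans ?_
      rw [l1Dist_comp_sub_right F E]
      rfl
    rw [h1, l1Dist_comm F E] at h3
    calc _ ≤ _ := h3
      _ ≤ (3 * l : ℝ≥0) + (((3 * l : ℝ≥0) + l1Dist μ B (fun x => C (x - (t + y₀)))) +
          (3 * l : ℝ≥0)) := by gcongr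
      _ = ((3 * l : ℝ≥0) + (3 * l : ℝ≥0) + (3 * l : ℝ≥0)) +
          l1Dist μ B (fun x => C (x - (t + y₀))) := by ring
      _ = _ := by norm_cast; ring_nf
  have hEω : ∫⁻ t, E t * translationModulus μ E t ∂μ ≤ η * η := by
    calc ∫⁻ t, E t * translationModulus μ E t ∂μ
        ≤ ∫⁻ t, (E t * (9 * l : ℝ≥0) + E t * l1Dist μ B (fun x => C (x - (t + y₀)))) ∂μ :=
          lintegral_mono fun t => by rw [← mul_add]; gcongr; exact hω t
      _ ≤ (9 * l : ℝ≥0) + (3 * l : ℝ≥0) := by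
          rw [lintegral_add_left (by fun_prop), lintegral_mul_const _ (by fun_prop), hE1, one_mul]
          gcongr
          refine le_trans (le_of_eq ?_) hAC
          exact lintegral_add_right_eq_self
            (fun t => (A t : ℝ≥0∞) * l1Dist μ B (fun x => C (x - t))) y₀
      _ ≤ _ := by
          norm_cast
          refine le_trans (le_of_eq ?_) hlη
          ring
  obtain ⟨H, hHc, hHo, hH⟩ := exists_addSubgroup_l1Dist_le hE hE1 hη hη1 hEω
  have hmem : ∀ x₀ x : G, x ∈ x₀ +ᵥ (H : Set G) ↔ x - x₀ ∈ (H : Set G) := fun x₀ x => by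
    rw [Set.mem_vadd_set_iff_neg_vadd_mem, vadd_eq_add, neg_add_eq_sub]
  have hshift : ∀ (x₀ : G) (c : ℝ≥0), ((x₀ +ᵥ (H : Set G)).indicator fun _ => c) =
      fun x => (H : Set G).indicator (fun _ => c) (x - x₀) := fun x₀ c => by
    classical
    funext x
    simp only [Set.indicator, hmem]
  have hprof : Measurable ((H : Set G).indicator fun _ => (μ H).toNNReal⁻¹) :=
    measurable_const.indicator hHo.measurableSet
  refine ⟨H, hHc, hHo, y₀, w₀, ?_, ?_⟩
  · rw [hshift]
    have hAE : A = fun x => E (x - y₀) := by funext x; simp [E]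
    rw [hAE, l1Dist_comp_sub_right]
    refine hH.trans ?_
    gcongr
    norm_num
  · rw [hshift]
    -- As H = -H, the profile is even, so B can be compared along B ≈ C(· - y₀) ≈ E(w₀ - ·) ≈
    -- profile. The total 6l + 6η is at most 7η because 12l ≤ η² and η ≤ 1/16.
    have hrefl : (fun x => (H : Set G).indicator (fun _ => (μ H).toNNReal⁻¹) (x - w₀)) =
        fun x => (H : Set G).indicator (fun _ => (μ H).toNNReal⁻¹) (w₀ - x) := by
      classical
      funext x
      simp only [Set.indicator]
      rw [← neg_sub w₀ x, SetLike.mem_coe, SetLike.mem_coe, neg_mem_iff]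
    have hCE : l1Dist μ (fun x => C (x - y₀)) (fun x => E (w₀ - x)) ≤ (3 * l : ℝ≥0) := by
      refine le_trans (le_of_eq ?_) hw₀
      rw [l1Dist_comm, ← l1Dist_comp_sub_right _ C y₀]
      congr 1
      funext x
      simp only [E]
      congr 1
      abel
    rw [hrefl]
    calc _ ≤ l1Dist μ B (fun x => C (x - y₀)) + _ := l1Dist_triangle _ hB (by fun_prop)
      _ ≤ l1Dist μ B (fun x => C (x - y₀)) + (l1Dist μ (fun x => C (x - y₀))
          (fun x => E (w₀ - x)) + _) := by
          gcongr
          exact l1Dist_triangle _ (by fun_prop) (by fun_prop)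
      _ ≤ (3 * l : ℝ≥0) + ((3 * l : ℝ≥0) + (6 * η : ℝ≥0)) := by
          gcongr
          rw [l1Dist_comp_sub_left E]
          exact hH
      _ ≤ _ := by
          norm_cast
          rw [← NNReal.coe_le_coe] at *
          push_cast at *
          nlinarith [η.coe_nonneg, l.coe_nonneg]

end Young

/-! ### From L¹ closeness of p-th powers to L^p closeness. -/

/-- If a - b ≤ κa, the first term suffices. Otherwise b < (1-κ)a, and a^p is at most a constant
times a^p - b^p. The argument covers p < 1 as well. -/
theorem Real.sub_rpow_le_of_le {a b p κ : ℝ} (hp : 0 < p) (hb : 0 ≤ b) (hab : b ≤ a)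
    (hκ : 0 < κ) (hκ1 : κ < 1) :
    (a - b) ^ p ≤ κ ^ p * (a ^ p + b ^ p) + (1 - (1 - κ) ^ p)⁻¹ * (a ^ p - b ^ p) := by
  have ha : 0 ≤ a := hb.trans hab
  have hpow : b ^ p ≤ a ^ p := Real.rpow_le_rpow hb hab hp.le
  have hgap : 0 < 1 - (1 - κ) ^ p :=
    sub_pos.2 (Real.rpow_lt_one (by linarith) (by linarith) hp)
  have hbp : 0 ≤ b ^ p := Real.rpow_nonneg hb p
  rcases le_or_gt (a - b) (κ * a) with h | h
  · have h1 : (a - b) ^ p ≤ κ ^ p * a ^ p := by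
      rw [← Real.mul_rpow hκ.le ha]
      exact Real.rpow_le_rpow (by linarith) h hp.le
    have h2 : 0 ≤ (1 - (1 - κ) ^ p)⁻¹ * (a ^ p - b ^ p) :=
      mul_nonneg (inv_nonneg.2 hgap.le) (by linarith)
    have h3 : 0 ≤ κ ^ p * b ^ p := by positivity
    linarith
  · have h1 : b ^ p ≤ (1 - κ) ^ p * a ^ p := by
      rw [← Real.mul_rpow (by linarith) ha]
      exact Real.rpow_le_rpow hb (by linarith) hp.le
    have h2 : (a - b) ^ p ≤ a ^ p := Real.rpow_le_rpow (by linarith) (by linarith) hp.le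
    have h3 : a ^ p ≤ (1 - (1 - κ) ^ p)⁻¹ * (a ^ p - b ^ p) := by
      rw [← div_eq_inv_mul, le_div_iff₀ hgap]
      linarith
    have h4 : 0 ≤ κ ^ p * (a ^ p + b ^ p) := by positivity
    linarith

/-- Uniform continuity of the Mazur map, in pointwise form. -/
theorem NNReal.exists_edist_rpow_le {p : ℝ} (hp : 0 < p) {τ : ℝ≥0} (hτ : 0 < τ) :
    ∃ K : ℝ≥0, ∀ a b : ℝ≥0, edist a b ^ p ≤
      τ * (((a ^ p : ℝ≥0) : ℝ≥0∞) + (b ^ p : ℝ≥0)) + K * edist (a ^ p) (b ^ p) := by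
  obtain ⟨κ, hκ, hκ1, hκτ⟩ : ∃ κ : ℝ, 0 < κ ∧ κ < 1 ∧ κ ^ p ≤ τ := by
    have hτ' : (0 : ℝ) < τ := by exact_mod_cast hτ
    refine ⟨min (1 / 2) ((τ : ℝ) ^ (1 / p)), by positivity,
      (min_le_left _ _).trans_lt (by norm_num), ?_⟩
    calc _ ≤ ((τ : ℝ) ^ (1 / p)) ^ p :=
          Real.rpow_le_rpow (by positivity) (min_le_right _ _) hp.le
      _ = τ := by rw [← Real.rpow_mul hτ'.le, one_div_mul_cancel hp.ne', Real.rpow_one]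
  have hgap : 0 < 1 - (1 - κ) ^ p :=
    sub_pos.2 (Real.rpow_lt_one (by linarith) (by linarith) hp)
  refine ⟨(1 - (1 - κ) ^ p)⁻¹.toNNReal, fun a b => ?_⟩
  rw [edist_nndist, edist_nndist, ← ENNReal.coe_rpow_of_nonneg _ hp.le]
  norm_cast
  rw [← NNReal.coe_le_coe]
  push_cast
  rw [Real.coe_toNNReal _ (inv_nonneg.2 hgap.le)]
  wlog hab : b ≤ a generalizing a b
  · have := this b a (le_of_not_ge hab)
    rwa [dist_comm b, dist_comm (b ^ p), add_comm ((b : ℝ) ^ p)] at this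
  have hab' : (b : ℝ) ≤ a := NNReal.coe_le_coe.2 hab
  have hpow : (b : ℝ) ^ p ≤ (a : ℝ) ^ p := Real.rpow_le_rpow b.coe_nonneg hab' hp.le
  rw [NNReal.dist_eq, NNReal.dist_eq, NNReal.coe_rpow, NNReal.coe_rpow,
    abs_of_nonneg (sub_nonneg.2 hab'), abs_of_nonneg (sub_nonneg.2 hpow)]
  refine (Real.sub_rpow_le_of_le hp b.coe_nonneg hab' hκ hκ1).trans ?_
  gcongr

theorem exists_eLpNorm_sub_indicator_le {p η : ℝ} (hp : 0 < p) (hη : 0 < η) :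
    ∃ δ : ℝ≥0, 0 < δ ∧ ∀ {X : Type*} [MeasurableSpace X] (ν : Measure X) (u : X → ℝ≥0)
      (c : ℝ≥0) (S : Set X), Measurable u → MeasurableSet S →
      ∫⁻ x, ((u x ^ p : ℝ≥0) : ℝ≥0∞) ∂ν = 1 →
      l1Dist ν (fun x => u x ^ p) (S.indicator fun _ => c) ≤ δ →
      eLpNorm (fun x => (u x : ℝ) - S.indicator (fun _ => (c : ℝ) ^ (1 / p)) x)
        (ENNReal.ofReal p) ν ≤ ENNReal.ofReal η := by
  obtain ⟨τ, hτ⟩ : ∃ τ : ℝ≥0, (τ : ℝ) = η ^ p := 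
    ⟨(η ^ p).toNNReal, Real.coe_toNNReal _ (by positivity)⟩
  have hτ0 : 0 < τ := by
    rw [← NNReal.coe_pos, hτ]; positivity
  obtain ⟨K, hK⟩ := NNReal.exists_edist_rpow_le hp (τ := τ / 6) (by positivity)
  -- With τ = η^p, the bound δ ≤ 1 makes (τ/6)(2 + δ) at most τ/2, and the other bound makes Kδ at
  -- most τ/2. The choice precedes the measure space, which keeps it uniform.
  refine ⟨min 1 (τ / (2 * (K + 1))), by positivity, fun {X} _ ν u c S hu hS hu1 hd => ?_⟩
  set δ := min 1 (τ / (2 * (K + 1)))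
  have hp0 : ENNReal.ofReal p ≠ 0 := by simpa using hp
  let w : X → ℝ≥0 := S.indicator fun _ => c
  have hw : Measurable w := measurable_const.indicator hS
  have hw1 : ∫⁻ x, (w x : ℝ≥0∞) ∂ν ≤ 1 + δ := by
    have := setLIntegral_le_add_l1Dist (μ := ν) (u := w) (v := fun x => u x ^ p)
      (by fun_prop) Set.univ
    rw [setLIntegral_univ, setLIntegral_univ, hu1, l1Dist_comm] at this
    exact this.trans (by gcongr)
  have hpt : ∀ x, ‖(u x : ℝ) - S.indicator (fun _ => (c : ℝ) ^ (1 / p)) x‖ₑ ^ p ≤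
      ((τ / 6 : ℝ≥0) : ℝ≥0∞) * (((u x ^ p : ℝ≥0) : ℝ≥0∞) + w x) + K * edist (u x ^ p) (w x) := by
    intro x
    have hcoe : S.indicator (fun _ => (c : ℝ) ^ (1 / p)) x = ((w x ^ (1 / p) : ℝ≥0) : ℝ) := by
      by_cases hx : x ∈ S
      · simp [w, hx]
      · simp [w, hx, hp.ne']
    have hwp : (w x ^ (1 / p)) ^ p = w x := by
      rw [← NNReal.rpow_mul, one_div_mul_cancel hp.ne', NNReal.rpow_one]
    have := hK (u x) (w x ^ (1 / p))
    rw [hwp] at this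
    rw [hcoe, ← edist_eq_enorm_sub]
    exact this
  rw [eLpNorm_eq_lintegral_rpow_enorm_toReal hp0 ENNReal.ofReal_ne_top,
    ENNReal.toReal_ofReal hp.le, one_div p, ENNReal.rpow_inv_le_iff hp,
    ENNReal.ofReal_rpow_of_pos hη, ← hτ, ENNReal.ofReal_coe_nnreal]
  simp only [← one_div]
  calc _ ≤ ∫⁻ x, (((τ / 6 : ℝ≥0) : ℝ≥0∞) * (((u x ^ p : ℝ≥0) : ℝ≥0∞) + w x) +
        K * edist (u x ^ p) (w x)) ∂ν := lintegral_mono hpt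
    _ = ((τ / 6 : ℝ≥0) : ℝ≥0∞) * (1 + ∫⁻ x, (w x : ℝ≥0∞) ∂ν) +
        K * l1Dist ν (fun x => u x ^ p) w := by
      rw [lintegral_add_left (by fun_prop), lintegral_const_mul _ (by fun_prop),
        lintegral_add_left (by fun_prop), hu1, lintegral_const_mul _ (by fun_prop), l1Dist]
    _ ≤ ((τ / 6 : ℝ≥0) : ℝ≥0∞) * (1 + (1 + δ)) + K * δ := by gcongr
    _ ≤ τ := by
      norm_cast
      have h1 : δ ≤ 1 := min_le_left _ _
      have h2 : δ * (2 * (K + 1)) ≤ τ := by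
        rw [← le_div_iff₀ (by positivity)]
        exact min_le_right _ _
      rw [← NNReal.coe_le_coe] at *
      push_cast at *
      nlinarith [δ.coe_nonneg, K.coe_nonneg, τ.coe_nonneg,
        mul_le_mul_of_nonneg_left h1 τ.coe_nonneg]

/-! ### Transfer to f and g, and choice of the constants. -/

/-- The assertion that `ε`-near extremizers are `η`-close to coset profiles. -/
def YoungStable.{u} (p q r s ε η : ℝ) : Prop :=
  ∀ (G : Type u) [AddCommGroup G] [TopologicalSpace G] [IsTopologicalAddGroup G]
    [LocallyCompactSpace G] [T2Space G] [SecondCountableTopology G]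
    [MeasurableSpace G] [BorelSpace G] (μ : Measure G) [μ.IsAddHaarMeasure]
    (f g : G → ℂ),
    MemLp f (ENNReal.ofReal p) μ → MemLp g (ENNReal.ofReal q) μ →
    eLpNorm f (ENNReal.ofReal p) μ = 1 → eLpNorm g (ENNReal.ofReal q) μ = 1 →
    ENNReal.ofReal (1 - ε) ≤ youngLHS μ r s f g →
    ∃ H : AddSubgroup G, IsCompact (H : Set G) ∧ IsOpen (H : Set G) ∧ ∃ x₀ x₀' : G,
      eLpNorm (fun x => ‖f x‖ - cosetProfile μ p H x₀ x) (ENNReal.ofReal p) μ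
        ≤ ENNReal.ofReal η ∧
      eLpNorm (fun x => ‖g x‖ - cosetProfile μ q H x₀' x) (ENNReal.ofReal q) μ
        ≤ ENNReal.ofReal η

theorem YoungStable.mono.{u} {p q r s ε ε' η η' : ℝ} (h : YoungStable.{u} p q r s ε η)
    (hε : ε' ≤ ε) (hη : η ≤ η') : YoungStable.{u} p q r s ε' η' := by
  intro G _ _ _ _ _ _ _ _ μ _ f g hf hg hf1 hg1 hY
  obtain ⟨H, hHc, hHo, x₀, x₀', h1, h2⟩ := h G μ f g hf hg hf1 hg1
    ((ENNReal.ofReal_le_ofReal (by linarith)).trans hY)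
  exact ⟨H, hHc, hHo, x₀, x₀', h1.trans (ENNReal.ofReal_le_ofReal hη),
    h2.trans (ENNReal.ofReal_le_ofReal hη)⟩

/-- A function of unit `L^p` norm has a measurable modulus whose `p`-th power is a density. -/
theorem exists_measurable_modulus {X : Type*} [MeasurableSpace X] {ν : Measure X} {p : ℝ}
    (hp : 0 < p) {f : X → ℂ} (hf : MemLp f (ENNReal.ofReal p) ν)
    (hf1 : eLpNorm f (ENNReal.ofReal p) ν = 1) :
    ∃ u : X → ℝ≥0, Measurable u ∧ (∀ᵐ x ∂ν, ‖f x‖₊ = u x) ∧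
      ∫⁻ x, ((u x ^ p : ℝ≥0) : ℝ≥0∞) ∂ν = 1 := by
  have hae : ∀ᵐ x ∂ν, ‖f x‖₊ = ‖hf.1.mk f x‖₊ := by
    filter_upwards [hf.1.ae_eq_mk] with x hx
    rw [hx]
  refine ⟨fun x => ‖hf.1.mk f x‖₊, hf.1.stronglyMeasurable_mk.measurable.nnnorm, hae, ?_⟩
  have hp0 : ENNReal.ofReal p ≠ 0 := by simpa using hp
  rw [eLpNorm_eq_lintegral_rpow_enorm_toReal hp0 ENNReal.ofReal_ne_top,
    ENNReal.toReal_ofReal hp.le] at hf1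
  have hf2 : ∫⁻ x, ‖f x‖ₑ ^ p ∂ν = 1 :=
    ENNReal.rpow_left_injective (one_div_pos.2 hp).ne' (hf1.trans (ENNReal.one_rpow _).symm)
  rw [← hf2]
  refine lintegral_congr_ae ?_
  filter_upwards [hae] with x hx
  rw [← hx, ENNReal.coe_rpow_of_nonneg _ hp.le]
  rfl

section Stability

variable {G : Type*} [AddCommGroup G] [TopologicalSpace G] [IsTopologicalAddGroup G]
  [LocallyCompactSpace G] [T2Space G] [SecondCountableTopology G] [MeasurableSpace G]
  [BorelSpace G] {μ : Measure G} [μ.IsAddHaarMeasure]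

theorem youngLHS_rpow_eq {p q r s : ℝ} (hp : 0 < p) (hq : 0 < q) (hr : 0 < r) (hs : 0 < s)
    {f g : G → ℂ} {u v : G → ℝ≥0} (hfu : ∀ᵐ x ∂μ, ‖f x‖₊ = u x) (hgv : ∀ᵐ x ∂μ, ‖g x‖₊ = v x) :
    youngLHS μ r s f g ^ s = ∫⁻ h, (∫⁻ x, ((u (x - h) ^ p : ℝ≥0) : ℝ≥0∞) ^ (r / p) *
      ((v x ^ q : ℝ≥0) : ℝ≥0∞) ^ (r / q) ∂μ) ^ (1 / (r / s)) ∂μ := by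
  have hr0 : ENNReal.ofReal r ≠ 0 := by simpa using hr
  rw [youngLHS, ← ENNReal.rpow_mul, one_div_mul_cancel hs.ne', ENNReal.rpow_one]
  refine lintegral_congr fun h => ?_
  rw [eLpNorm_eq_lintegral_rpow_enorm_toReal hr0 ENNReal.ofReal_ne_top,
    ENNReal.toReal_ofReal hr.le, ← ENNReal.rpow_mul]
  have hexp : 1 / r * s = 1 / (r / s) := by field_simp
  rw [hexp]
  congr 1
  refine lintegral_congr_ae ?_
  have hshift : ∀ᵐ x ∂μ, ‖f (x - h)‖₊ = u (x - h) :=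
    (measurePreserving_sub_right μ h).quasiMeasurePreserving.ae hfu
  have hpow : ∀ (t : ℝ≥0) {a : ℝ}, 0 < a → ((t ^ a : ℝ≥0) : ℝ≥0∞) ^ (r / a) = (t : ℝ≥0∞) ^ r :=
    fun t a ha => by
      rw [ENNReal.coe_rpow_of_nonneg _ ha.le, ← ENNReal.rpow_mul, mul_div_cancel₀ _ ha.ne']
  filter_upwards [hshift, hgv] with x hx hx'
  rw [hpow _ hp, hpow _ hq, ← hx, ← hx', shift, enorm_mul,
    ENNReal.mul_rpow_of_nonneg _ _ hr.le]
  rfl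

theorem eLpNorm_sub_cosetProfile {p : ℝ} {f : G → ℂ} {u : G → ℝ≥0}
    (hfu : ∀ᵐ x ∂μ, ‖f x‖₊ = u x) (H : AddSubgroup G) (x₀ : G) :
    eLpNorm (fun x => ‖f x‖ - cosetProfile μ p H x₀ x) (ENNReal.ofReal p) μ =
      eLpNorm (fun x => (u x : ℝ) - (x₀ +ᵥ (H : Set G)).indicator
        (fun _ => (((μ H).toNNReal⁻¹ : ℝ≥0) : ℝ) ^ (1 / p)) x) (ENNReal.ofReal p) μ := by
  refine eLpNorm_congr_ae ?_
  filter_upwards [hfu] with x hx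
  rw [← hx, coe_nnnorm, cosetProfile]
  congr 3
  funext _
  rw [NNReal.coe_inv, Real.inv_rpow NNReal.zero_le_coe, ← Real.rpow_neg NNReal.zero_le_coe]
  rfl

end Stability

theorem exists_youngStable.{u} {p q r s : ℝ} (hr : 0 < r) (hrp : r < p) (hrq : r < q)
    (hps : p < s) (hqs : q < s) (hpqrs : 1 / r + 1 / s = 1 / p + 1 / q) {η : ℝ} (hη : 0 < η) :
    ∃ ε : ℝ, 0 < ε ∧ YoungStable.{u} p q r s ε η := by
  have hp : 0 < p := hr.trans hrp
  have hq : 0 < q := hr.trans hrq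
  have hs : 0 < s := hp.trans hps
  obtain ⟨δ₁, hδ₁, h₁⟩ := exists_eLpNorm_sub_indicator_le.{u} hp hη
  obtain ⟨δ₂, hδ₂, h₂⟩ := exists_eLpNorm_sub_indicator_le.{u} hq hη
  obtain ⟨σ, hσ⟩ : ∃ σ : ℝ≥0, (σ : ℝ) = r / s :=
    ⟨_, Real.coe_toNNReal _ (div_pos hr hs).le⟩
  have hα0 : 0 < r / p - r / s := sub_pos.2 (div_lt_div_of_pos_left hr hp hps)
  have hβ0 : 0 < r / q - r / s := sub_pos.2 (div_lt_div_of_pos_left hr hq hqs)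
  obtain ⟨α, hα⟩ : ∃ α : ℝ≥0, (α : ℝ) = r / p - r / s := ⟨_, Real.coe_toNNReal _ hα0.le⟩
  obtain ⟨β, hβ⟩ : ∃ β : ℝ≥0, (β : ℝ) = r / q - r / s := ⟨_, Real.coe_toNNReal _ hβ0.le⟩
  have hσ0 : 0 < σ := by rw [← NNReal.coe_pos, hσ]; positivity
  rw [← hα, NNReal.coe_pos] at hα0
  rw [← hβ, NNReal.coe_pos] at hβ0
  -- This is the exponent relation multiplied by r.
  have hsum : σ + α + β = 1 := by
    rw [← NNReal.coe_inj]
    push_cast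
    rw [hσ, hα, hβ]
    have := congrArg (fun t => r * t) hpqrs
    simp only [mul_add, mul_one_div, div_self hr.ne'] at this
    linarith
  have hσα : ((σ + α : ℝ≥0) : ℝ) = r / p := by push_cast; rw [hσ, hα]; ring
  have hσβ : ((σ + β : ℝ≥0) : ℝ) = r / q := by push_cast; rw [hσ, hβ]; ring
  let m := min σ (min α β)
  have hm : 0 < m := lt_min hσ0 (lt_min hα0 hβ0)
  let θ := min (1 / 16) (min (δ₁ / 7) (δ₂ / 7))
  have hθ : 0 < θ := by positivity
  have hθ₁ : 7 * θ ≤ δ₁ := by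
    rw [mul_comm, ← le_div_iff₀ (by norm_num)]
    exact (min_le_right _ _).trans (min_le_left _ _)
  have hθ₂ : 7 * θ ≤ δ₂ := by
    rw [mul_comm, ← le_div_iff₀ (by norm_num)]
    exact (min_le_right _ _).trans (min_le_right _ _)
  let l := θ * θ / 12
  have hl : 0 < l := by positivity
  have hlθ : 12 * l ≤ θ * θ := (mul_div_cancel₀ _ (by norm_num)).le
  have hκ : 0 < m * l ^ 2 := by positivity
  obtain ⟨κ, hκ0, hκ1, hκm⟩ : ∃ κ : ℝ, 0 < κ ∧ κ < 1 ∧ κ ≤ (m * l ^ 2 : ℝ≥0) :=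
    ⟨min (1 / 2) (m * l ^ 2 : ℝ≥0), lt_min (by norm_num) (NNReal.coe_pos.2 hκ),
      (min_le_left _ _).trans_lt (by norm_num), min_le_right _ _⟩
  -- This ε satisfies (1 - ε)^s = 1 - κ, so the s-th power of the functional has deficit at most κ ≤
  -- ml².
  refine ⟨1 - (1 - κ) ^ (1 / s),
    sub_pos.2 (Real.rpow_lt_one (by linarith) (by linarith) (by positivity)), ?_⟩
  intro G _ _ _ _ _ _ _ _ μ _ f g hf hg hf1 hg1 hY
  obtain ⟨u, hu, hfu, hu1⟩ := exists_measurable_modulus hp hf hf1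
  obtain ⟨v, hv, hgv, hv1⟩ := exists_measurable_modulus hq hg hg1
  have hY' : (1 : ℝ≥0∞) ≤ youngLHS μ r s f g ^ s + (m * l ^ 2 : ℝ≥0) := by
    have h3 := ENNReal.rpow_le_rpow hY hs.le
    rw [sub_sub_cancel, ENNReal.ofReal_rpow_of_nonneg (by positivity) hs.le,
      ← Real.rpow_mul (by linarith), one_div_mul_cancel hs.ne', Real.rpow_one] at h3
    calc (1 : ℝ≥0∞) = ENNReal.ofReal (1 - κ) + ENNReal.ofReal κ := by
          rw [← ENNReal.ofReal_add (by linarith) hκ0.le, sub_add_cancel, ENNReal.ofReal_one]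
      _ ≤ _ := by
          gcongr
          rw [← ENNReal.ofReal_coe_nnreal]
          exact ENNReal.ofReal_le_ofReal hκm
  rw [youngLHS_rpow_eq hp hq hr hs hfu hgv, ← hσα, ← hσβ, ← hσ] at hY'
  obtain ⟨H, hHc, hHo, x₀, x₀', hA, hB⟩ := exists_addSubgroup_of_young
    (A := fun x => u x ^ p) (B := fun x => v x ^ q) (by fun_prop) (by fun_prop) hu1 hv1 hm hl
    (min_le_left _ _) ((min_le_right _ _).trans (min_le_left _ _))
    ((min_le_right _ _).trans (min_le_right _ _)) hsum hθ (min_le_left _ _) hlθ hY'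
  refine ⟨H, hHc, hHo, x₀, x₀', ?_, ?_⟩
  · rw [eLpNorm_sub_cosetProfile hfu]
    exact h₁ μ u _ _ hu (hHo.measurableSet.const_vadd _) hu1
      (hA.trans (by exact_mod_cast hθ₁))
  · rw [eLpNorm_sub_cosetProfile hgv]
    exact h₂ μ v _ _ hv (hHo.measurableSet.const_vadd _) hv1
      (hB.trans (by exact_mod_cast hθ₂))

/-- A monotone relation with qualitative bounds admits a modulus. -/
theorem exists_modulus {P : ℝ → ℝ → Prop}
    (hP : ∀ {ε ε' η η' : ℝ}, P ε η → ε' ≤ ε → η ≤ η' → P ε' η')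
    (hex : ∀ η : ℝ, 0 < η → ∃ ε : ℝ, 0 < ε ∧ P ε η) :
    ∃ ε₀ : ℝ, 0 < ε₀ ∧ ∃ c : ℝ → ℝ, Tendsto c (𝓝[>] 0) (𝓝 0) ∧
      ∀ ε, 0 < ε → ε ≤ ε₀ → P ε (c ε) := by
  obtain ⟨ε₀, hε₀, h₀⟩ := hex 1 one_pos
  have hbdd : ∀ ε, BddBelow {η : ℝ | 0 < η ∧ P ε η} := fun ε => ⟨0, fun η hη => hη.1.le⟩
  -- The infimum need not be attained; adding ε places c(ε) above an admissible η and still tends to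
  -- 0. For ε ≤ ε₀ the set contains 1.
  refine ⟨ε₀, hε₀, fun ε => sInf {η : ℝ | 0 < η ∧ P ε η} + ε, ?_, fun ε hε hle => ?_⟩
  · rw [Metric.tendsto_nhds]
    intro η hη
    obtain ⟨ε₁, hε₁, h₁⟩ := hex (η / 2) (by positivity)
    filter_upwards [Ioo_mem_nhdsGT (lt_min hε₁ (half_pos hη))] with ε hε
    have hle : sInf {η : ℝ | 0 < η ∧ P ε η} ≤ η / 2 :=
      csInf_le (hbdd ε) ⟨by positivity, hP h₁ (hε.2.le.trans (min_le_left _ _)) le_rfl⟩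
    have hnn : 0 ≤ sInf {η : ℝ | 0 < η ∧ P ε η} := Real.sInf_nonneg fun η hη => hη.1.le
    have := hε.2.trans_le (min_le_right _ _)
    rw [Real.dist_eq, sub_zero, abs_of_nonneg (by linarith [hε.1])]
    linarith
  · obtain ⟨η, hη, hlt⟩ := exists_lt_of_csInf_lt
      (⟨1, one_pos, hP h₀ hle le_rfl⟩ : {η : ℝ | 0 < η ∧ P ε η}.Nonempty)
      (lt_add_of_pos_right _ hε)
    exact hP hη.2 le_rfl hlt.le

theorem proposition5p4 (p q r s : ℝ) (hr : 0 < r) (hrp : r < p) (hrq : r < q)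
    (hps : p < s) (hqs : q < s) (hpqrs : 1 / r + 1 / s = 1 / p + 1 / q) :
    ∃ ε₀ : ℝ, 0 < ε₀ ∧ ∃ c : ℝ → ℝ, Tendsto c (𝓝[>] 0) (𝓝 0) ∧
      ∀ (G : Type*) [AddCommGroup G] [TopologicalSpace G] [IsTopologicalAddGroup G]
        [LocallyCompactSpace G] [T2Space G] [SecondCountableTopology G]
        [MeasurableSpace G] [BorelSpace G] (μ : Measure G) [μ.IsAddHaarMeasure]
        (f g : G → ℂ) (ε : ℝ),
        0 < ε → ε ≤ ε₀ →
        MemLp f (ENNReal.ofReal p) μ → MemLp g (ENNReal.ofReal q) μ →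
        eLpNorm f (ENNReal.ofReal p) μ = 1 → eLpNorm g (ENNReal.ofReal q) μ = 1 →
        ENNReal.ofReal (1 - ε) ≤ youngLHS μ r s f g →
        ∃ H : AddSubgroup G, IsCompact (H : Set G) ∧ IsOpen (H : Set G) ∧ ∃ x₀ x₀' : G,
          eLpNorm (fun x => ‖f x‖ - cosetProfile μ p H x₀ x) (ENNReal.ofReal p) μ
            ≤ ENNReal.ofReal (c ε) ∧
          eLpNorm (fun x => ‖g x‖ - cosetProfile μ q H x₀' x) (ENNReal.ofReal q) μ
            ≤ ENNReal.ofReal (c ε) := by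
  obtain ⟨ε₀, hε₀, c, hc, h⟩ := exists_modulus (P := YoungStable p q r s) YoungStable.mono
    fun η hη => exists_youngStable hr hrp hrq hps hqs hpqrs hη
  exact ⟨ε₀, hε₀, c, hc, fun G _ _ _ _ _ _ _ _ μ _ f g ε hε hle hf hg hf1 hg1 hY =>
    h ε hε hle G μ f g hf hg hf1 hg1 hY⟩
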